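/- Let $q\in\mathbb{R}\setminus\{0\}$. Let $\mu$ be a probability measure on $\mathbb{R}$ with compact support which is absolutely continuous with respect to Lebesgue measure and whose density is bounded (almost everywhere) by $1/|q|$. Then there exists a unique probability measure $\nu$ on $\mathbb{R}$ with compact support such that $$\exp\Big(-q\sum_{k=0}^{\infty}\mu_k z^{k+1}\Big)=1-q\sum_{k=0}^{\infty}\nu_k z^{k+1}$$ for all $z\in\mathbb{C}$ in some neighbourhood of $0$ (both series converging there), where $\mu_k=\int x^k\,\mu(dx)$ and $\nu_k=\int x^k\,\nu(dx)$ are the moments of $\mu$ and $\nu$. Moreover, the map $MK_{(q)}$ that sends $\mu$ to $\nu$ is a bijection from the set of compactly supported, absolutely continuous probability measures on $\mathbb{R}$ with density bounded by $1/|q|$ onto the set of all compactly supported probability measures on $\mathbb{R}$. -/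

import Mathlib

open MeasureTheory ProbabilityTheory Filter Topology

/-- Probability measures on `ℝ` with compact (topological) support. -/
def CompactProb : Type :=
  {ν : ProbabilityMeasure ℝ // IsCompact (ν : Measure ℝ).support}

/-- Probability measures on `ℝ` with compact support which are absolutely continuous with respect
to Lebesgue measure, with density (Radon-Nikodym derivative) bounded by `1 / |q|` almost
everywhere. -/
def BoundedDensityProb (q : ℝ) : Type :=
  {μ : ProbabilityMeasure ℝ // IsCompact (μ : Measure ℝ).support ∧ (μ : Measure ℝ) ≪ volume ∧
    ∀ᵐ x ∂(volume : Measure ℝ), (μ : Measure ℝ).rnDeriv volume x ≤ ENNReal.ofReal (1 / |q|)}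

/-- The underlying measure. -/
def CompactProb.toMeasure (ν : CompactProb) : Measure ℝ := (ν.1 : Measure ℝ)

/-- The underlying measure. -/
def BoundedDensityProb.toMeasure {q : ℝ} (μ : BoundedDensityProb q) : Measure ℝ :=
  (μ.1 : Measure ℝ)

/-- The `k`-th term `m_k z ^ (k + 1)` of the moment series of a measure on `ℝ`,
where `m_k = ∫ x ^ k` is its `k`-th moment. -/
noncomputable def momentTerm (ρ : Measure ℝ) (z : ℂ) (k : ℕ) : ℂ :=
  ((moment id k ρ : ℝ) : ℂ) * z ^ (k + 1)

/-- The relation `exp (-q ∑ μ_k z ^ (k + 1)) = 1 - q ∑ ν_k z ^ (k + 1)`, as an identity between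
(convergent) power series in a neighbourhood of `z = 0` in `ℂ`. -/
def MarkovKreinRel (q : ℝ) (μ ν : Measure ℝ) : Prop :=
  ∀ᶠ z in 𝓝 (0 : ℂ), Summable (momentTerm μ z) ∧ Summable (momentTerm ν z) ∧
    Complex.exp (-(q : ℂ) * ∑' k, momentTerm μ z k) = 1 - (q : ℂ) * ∑' k, momentTerm ν z k

/-! Dilating both measures by `q⁻¹` reduces everything to `q = 1`: the density bound becomes `μ ≤
volume`, and the relation reads `exp (-∫ z / (1 - x z) dμ) = 1 - ∫ z / (1 - x z) dν` near `0`.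

There is an explicit finite model. If `μ` is Lebesgue measure on disjoint intervals `(x, y x]`, the
left side is the rational function `∏ (1 - y x z) / (1 - x z)`, and partial fractions turn it into
`1 - ∑ p x * z / (1 - x z)`. Interlacing of the `x` and `y x` gives `p ≥ 0`
(`Interlaces.nodeResidue_nonneg`); conversely, positive weights of sum `1` give interlacing roots
(`exists_interlaces_of_pos`). The total masses `∑ p x` and `∑ (y x - x)` agree.

Existence in both directions follows by approximation: `μ` is replaced on a fine mesh by Lebesgue
measure on short intervals, `ν` by its images under simple functions. The partner measures stay in a
fixed compact interval, so they have a weak limit along an ultrafilter, and the relation passes to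
the limit; so does `≤ volume` (`le_volume_of_tendsto`).

Uniqueness holds because the germ at `0` of `∫ z / (1 - x z) dρ` determines the moments, which
determine a compactly supported `ρ`; to recover `μ`, the exponential is first inverted by the
principal logarithm near `0`. -/

/-! ### The kernel and the moment series -/

/-- The function `x ↦ z / (1 - x z)`, whose integral is the moment series. -/
noncomputable def cauchyKernel (z : ℂ) (x : ℝ) : ℂ := z / (1 - x * z)

lemma norm_ofReal_mul_lt_one {R x : ℝ} {z : ℂ} (hx : x ∈ Set.Icc (-R) R) (hz : ‖z‖ * R < 1) :
    ‖(x : ℂ) * z‖ < 1 := by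
  rw [norm_mul, Complex.norm_real, Real.norm_eq_abs]
  have := abs_le.2 hx
  nlinarith [norm_nonneg z]

lemma one_sub_mul_mem_slitPlane {R x : ℝ} {z : ℂ} (hx : x ∈ Set.Icc (-R) R)
    (hz : ‖z‖ * R < 1) : 1 - (x : ℂ) * z ∈ Complex.slitPlane := by
  rw [sub_eq_add_neg]
  apply Complex.mem_slitPlane_of_norm_lt_one
  simpa using norm_ofReal_mul_lt_one hx hz

lemma one_sub_mul_ne_zero {R x : ℝ} {z : ℂ} (hx : x ∈ Set.Icc (-R) R)
    (hz : ‖z‖ * R < 1) : 1 - (x : ℂ) * z ≠ 0 :=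
  Complex.slitPlane_ne_zero (one_sub_mul_mem_slitPlane hx hz)

lemma one_sub_le_norm_one_sub_mul {R x : ℝ} {z : ℂ} (hx : x ∈ Set.Icc (-R) R) :
    1 - ‖z‖ * R ≤ ‖1 - (x : ℂ) * z‖ := by
  have h1 : ‖(x : ℂ) * z‖ ≤ ‖z‖ * R := by
    rw [norm_mul, Complex.norm_real, Real.norm_eq_abs, mul_comm]
    exact mul_le_mul_of_nonneg_left (abs_le.2 hx) (norm_nonneg z)
  have h2 := norm_sub_norm_le (1 : ℂ) ((x : ℂ) * z)
  rw [norm_one] at h2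
  linarith

lemma norm_cauchyKernel_le {R x : ℝ} {z : ℂ} (hx : x ∈ Set.Icc (-R) R) (hz : ‖z‖ * R < 1) :
    ‖cauchyKernel z x‖ ≤ ‖z‖ / (1 - ‖z‖ * R) := by
  rw [cauchyKernel, norm_div]
  exact div_le_div_of_nonneg_left (norm_nonneg z) (by linarith) (one_sub_le_norm_one_sub_mul hx)

lemma norm_cauchyKernel_sub_le {R x y : ℝ} {z : ℂ} (hx : x ∈ Set.Icc (-R) R)
    (hy : y ∈ Set.Icc (-R) R) (hz : ‖z‖ * R < 1) :
    ‖cauchyKernel z x - cauchyKernel z y‖ ≤ (‖z‖ / (1 - ‖z‖ * R)) ^ 2 * |x - y| := by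
  -- Resolvent identity.
  have h : cauchyKernel z x - cauchyKernel z y =
      cauchyKernel z x * cauchyKernel z y * ((x - y : ℝ) : ℂ) := by
    have h1 := one_sub_mul_ne_zero hx hz
    have h2 := one_sub_mul_ne_zero hy hz
    simp only [cauchyKernel]
    rw [div_sub_div _ _ h1 h2, div_mul_div_comm, div_mul_eq_mul_div]
    push_cast
    congr 1
    ring
  rw [h, norm_mul, norm_mul, Complex.norm_real, Real.norm_eq_abs, sq]
  have h1 := norm_cauchyKernel_le hx hz
  have h2 := norm_cauchyKernel_le hy hz
  gcongr

lemma continuousOn_cauchyKernel {R : ℝ} {z : ℂ} (hz : ‖z‖ * R < 1) :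
    ContinuousOn (cauchyKernel z) (Set.Icc (-R) R) := by
  unfold cauchyKernel
  refine ContinuousOn.div (by fun_prop) (by fun_prop) fun x hx => one_sub_mul_ne_zero hx hz

lemma measurable_cauchyKernel (z : ℂ) : Measurable (cauchyKernel z) := by
  unfold cauchyKernel
  fun_prop

lemma ae_mem_Icc {ρ : Measure ℝ} {R : ℝ} (h : ρ (Set.Icc (-R) R)ᶜ = 0) :
    ∀ᵐ x ∂ρ, x ∈ Set.Icc (-R) R := h

lemma integrable_cauchyKernel {ρ : Measure ℝ} [IsFiniteMeasure ρ] {R : ℝ} {z : ℂ}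
    (h : ρ (Set.Icc (-R) R)ᶜ = 0) (hz : ‖z‖ * R < 1) : Integrable (cauchyKernel z) ρ := by
  refine Integrable.of_bound (measurable_cauchyKernel z).aestronglyMeasurable
    (‖z‖ / (1 - ‖z‖ * R)) ?_
  filter_upwards [ae_mem_Icc h] with x hx using norm_cauchyKernel_le hx hz

lemma hasSum_momentTerm {ρ : Measure ℝ} [IsFiniteMeasure ρ] {R : ℝ} {z : ℂ} (hR : 0 ≤ R)
    (h : ρ (Set.Icc (-R) R)ᶜ = 0) (hz : ‖z‖ * R < 1) :
    HasSum (momentTerm ρ z) (∫ x, cauchyKernel z x ∂ρ) := by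
  have hb : ∀ k : ℕ, ∀ᵐ x : ℝ ∂ρ, ‖(x : ℂ) ^ k * z ^ (k + 1)‖ ≤ (‖z‖ * R) ^ k * ‖z‖ := by
    intro k
    filter_upwards [ae_mem_Icc h] with x hx
    rw [norm_mul, norm_pow, norm_pow, Complex.norm_real, Real.norm_eq_abs, pow_succ, mul_pow,
      ← mul_assoc, mul_comm (‖z‖ ^ k)]
    have := abs_le.2 hx
    gcongr
  have hint : ∀ k : ℕ, Integrable (fun x : ℝ => (x : ℂ) ^ k * z ^ (k + 1)) ρ := fun k =>
    Integrable.of_bound (by fun_prop) _ (hb k)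
  have hs : Summable fun k : ℕ => ∫ x : ℝ, ‖(x : ℂ) ^ k * z ^ (k + 1)‖ ∂ρ := by
    have hg := summable_geometric_of_lt_one (by positivity) hz
    refine Summable.of_nonneg_of_le (fun k => integral_nonneg fun x => norm_nonneg _)
      (fun k => ?_) ((hg.mul_right ‖z‖).mul_left (ρ.real Set.univ))
    calc _ ≤ ∫ _, (‖z‖ * R) ^ k * ‖z‖ ∂ρ :=
          integral_mono_ae (hint k).norm (integrable_const _) (hb k)
      _ = _ := by simp
  have key := hasSum_integral_of_summable_integral_norm hint hs
  have h1 : ∀ k : ℕ, ∫ x : ℝ, (x : ℂ) ^ k * z ^ (k + 1) ∂ρ = momentTerm ρ z k := by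
    intro k
    rw [integral_mul_const, momentTerm, moment, ← integral_complex_ofReal]
    simp
  have h2 : ∫ x : ℝ, ∑' k : ℕ, (x : ℂ) ^ k * z ^ (k + 1) ∂ρ = ∫ x, cauchyKernel z x ∂ρ := by
    refine integral_congr_ae ?_
    filter_upwards [ae_mem_Icc h] with x hx
    have := tsum_geometric_of_norm_lt_one (norm_ofReal_mul_lt_one hx hz)
    rw [cauchyKernel, div_eq_mul_inv, ← this, ← tsum_mul_left]
    exact tsum_congr fun k => by ring
  rw [h2] at key
  simpa only [h1] using key

/-! ### Weak limits on a fixed interval -/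

lemma tendsto_integral_cauchyKernel {ι : Type*} {L : Filter ι} {ρ : ι → ProbabilityMeasure ℝ}
    {σ : ProbabilityMeasure ℝ} {R : ℝ} {z : ℂ} (hR : 0 ≤ R) (hz : ‖z‖ * R < 1)
    (hρ : ∀ i, (ρ i : Measure ℝ) (Set.Icc (-R) R)ᶜ = 0)
    (hσ : (σ : Measure ℝ) (Set.Icc (-R) R)ᶜ = 0) (h : Tendsto ρ L (𝓝 σ)) :
    Tendsto (fun i => ∫ x, cauchyKernel z x ∂(ρ i : Measure ℝ)) L
      (𝓝 (∫ x, cauchyKernel z x ∂(σ : Measure ℝ))) := by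
  have hle : -R ≤ R := by linarith
  -- The kernel may have a pole outside `[-R, R]`; freezing it beyond the end points gives a bounded
  -- continuous test function.
  let f : BoundedContinuousFunction ℝ ℂ := BoundedContinuousFunction.ofNormedAddCommGroup
    (fun x => cauchyKernel z (Set.projIcc (-R) R hle x))
    ((continuousOn_cauchyKernel hz).comp_continuous
      (continuous_subtype_val.comp continuous_projIcc) fun x => Subtype.prop _)
    (‖z‖ / (1 - ‖z‖ * R)) fun x => norm_cauchyKernel_le (Subtype.prop _) hz
  have hf : ∀ τ : Measure ℝ, τ (Set.Icc (-R) R)ᶜ = 0 →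
      ∫ x, f x ∂τ = ∫ x, cauchyKernel z x ∂τ := fun τ hτ => by
    refine integral_congr_ae ?_
    filter_upwards [ae_mem_Icc hτ] with x hx
    simp [f, Set.projIcc_of_mem hle hx]
  have := (ProbabilityMeasure.tendsto_iff_forall_integral_rclike_tendsto ℂ).1 h f
  rw [hf _ hσ] at this
  simpa only [hf _ (hρ _)] using this

/-- Probability measures carried by a fixed compact interval converge weakly along some
ultrafilter. -/
lemma exists_ultrafilter_tendsto (ρ : ℕ → ProbabilityMeasure ℝ) {R : ℝ}
    (hρ : ∀ n, (ρ n : Measure ℝ) (Set.Icc (-R) R)ᶜ = 0) :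
    ∃ (U : Ultrafilter ℕ) (σ : ProbabilityMeasure ℝ), (U : Filter ℕ) ≤ atTop ∧
      (σ : Measure ℝ) (Set.Icc (-R) R)ᶜ = 0 ∧ Tendsto ρ U (𝓝 σ) := by
  -- Tightness with a constant compact set and zero allowed mass outside it.
  have hc := isCompact_setOfPred_probabilityMeasure_mass_eq_compl_isCompact_le (E := ℝ)
    (u := fun _ => 0) (K := fun _ => Set.Icc (-R) R) tendsto_const_nhds
    (fun _ => isCompact_Icc) (Or.inr monotone_const)
  obtain ⟨σ, hσ, hle⟩ := hc.ultrafilter_le_nhds ((Ultrafilter.of atTop).map ρ) (by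
    refine le_principal_iff.2 (Ultrafilter.mem_coe.2 (Ultrafilter.mem_map.2 ?_))
    refine Filter.univ_mem' fun n _ => ?_
    simp [hρ n])
  refine ⟨Ultrafilter.of atTop, σ, Ultrafilter.of_le _, ?_, hle⟩
  have := hσ 0
  simpa using this

/-! ### Partial fractions and interlacing roots -/

open Polynomial in
/-- The polynomial `∏ (X - x) * (1 - ∑ p x / (X - x))`, with all denominators cleared. -/
noncomputable def secularPolynomial (s : Finset ℝ) (p : ℝ → ℝ) : ℝ[X] :=
  Lagrange.nodal s id - ∑ x ∈ s, C (p x) * Lagrange.nodal (s.erase x) id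

open Polynomial in
lemma degree_sum_C_mul_nodal_erase_lt (s : Finset ℝ) (p : ℝ → ℝ) :
    (∑ x ∈ s, C (p x) * Lagrange.nodal (s.erase x) id).degree < s.card := by
  rw [← Polynomial.mem_degreeLT]
  refine Submodule.sum_mem _ fun x hx => ?_
  rw [Polynomial.mem_degreeLT]
  have h := degree_mul_le (C (p x)) (Lagrange.nodal (s.erase x) id)
  refine lt_of_le_of_lt (h.trans (add_le_of_nonpos_left degree_C_le)) ?_
  rw [Lagrange.degree_nodal, Nat.cast_lt]
  exact Finset.card_erase_lt_of_mem hx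

lemma degree_secularPolynomial (s : Finset ℝ) (p : ℝ → ℝ) :
    (secularPolynomial s p).degree = s.card := by
  rw [secularPolynomial, Polynomial.degree_sub_eq_left_of_degree_lt, Lagrange.degree_nodal]
  rw [Lagrange.degree_nodal]
  exact degree_sum_C_mul_nodal_erase_lt s p

lemma monic_secularPolynomial (s : Finset ℝ) (p : ℝ → ℝ) : (secularPolynomial s p).Monic := by
  refine Polynomial.Monic.sub_of_left Lagrange.nodal_monic ?_
  rw [Lagrange.degree_nodal]
  exact degree_sum_C_mul_nodal_erase_lt s p

lemma eval_secularPolynomial (s : Finset ℝ) (p : ℝ → ℝ) (w : ℝ) :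
    (secularPolynomial s p).eval w =
      ∏ x ∈ s, (w - x) - ∑ x ∈ s, p x * ∏ x' ∈ s.erase x, (w - x') := by
  simp [secularPolynomial, Polynomial.eval_finsetSum, Lagrange.eval_nodal]

lemma eval_secularPolynomial_node {s : Finset ℝ} (p : ℝ → ℝ) {x : ℝ} (hx : x ∈ s) :
    (secularPolynomial s p).eval x = -(p x * ∏ x' ∈ s.erase x, (x - x')) := by
  rw [eval_secularPolynomial, Finset.prod_eq_zero hx (sub_self x), zero_sub,
    Finset.sum_eq_single_of_mem x hx]
  intro b hb hne
  rw [Finset.prod_eq_zero (Finset.mem_erase.2 ⟨hne.symm, hx⟩) (sub_self x), mul_zero]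

lemma prod_erase_sub_ne_zero (s : Finset ℝ) (x : ℝ) : ∏ x' ∈ s.erase x, (x - x') ≠ 0 :=
  Finset.prod_ne_zero_iff.2 fun _ h => sub_ne_zero.2 (Finset.ne_of_mem_erase h).symm

/-- The residues of `1 - ∏ (w - y x) / (w - x)`. -/
noncomputable def nodeResidue (s : Finset ℝ) (y : ℝ → ℝ) (x : ℝ) : ℝ :=
  -(∏ x' ∈ s, (x - y x')) / ∏ x' ∈ s.erase x, (x - x')

/-- Lagrange interpolation: both sides are monic of degree `s.card`, so agreement at the `s.card`
nodes suffices. -/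
lemma secularPolynomial_nodeResidue (s : Finset ℝ) (y : ℝ → ℝ) :
    secularPolynomial s (nodeResidue s y) = Lagrange.nodal s y := by
  refine Polynomial.eq_of_degree_le_of_eval_finset_eq s (degree_secularPolynomial s _).le ?_ ?_ ?_
  · rw [degree_secularPolynomial, Lagrange.degree_nodal]
  · rw [(monic_secularPolynomial s _).leadingCoeff, Lagrange.nodal_monic.leadingCoeff]
  · intro x hx
    rw [eval_secularPolynomial_node _ hx, Lagrange.eval_nodal, nodeResidue,
      div_mul_cancel₀ _ (prod_erase_sub_ne_zero s x), neg_neg]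

/-- Compare the coefficients of degree `s.card - 1`: a nodal polynomial contributes minus the sum of
its roots, and each erased product is monic of that degree. Total mass is thus preserved. -/
lemma sum_eq_sum_sub_of_secularPolynomial_eq {s : Finset ℝ} {p y : ℝ → ℝ}
    (h : secularPolynomial s p = Lagrange.nodal s y) : ∑ x ∈ s, p x = ∑ x ∈ s, (y x - x) := by
  rcases s.eq_empty_or_nonempty with rfl | hs
  · simp
  have h1 := congrArg (fun P => Polynomial.coeff P (s.card - 1)) h
  simp only [secularPolynomial, Polynomial.coeff_sub, Polynomial.finsetSum_coeff,
    Polynomial.coeff_C_mul, Lagrange.nodal_eq] at h1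
  rw [Polynomial.prod_X_sub_C_coeff_card_pred _ _ hs.card_pos,
    Polynomial.prod_X_sub_C_coeff_card_pred _ _ hs.card_pos] at h1
  have h2 : ∀ x ∈ s, p x * (∏ i ∈ s.erase x, (Polynomial.X - Polynomial.C (id i))).coeff
      (s.card - 1) = p x := by
    intro x hx
    have h3 : (Lagrange.nodal (s.erase x) (id : ℝ → ℝ)).coeff (s.card - 1) = 1 := by
      have := (Lagrange.nodal_monic (s := s.erase x) (v := (id : ℝ → ℝ))).coeff_natDegree
      rwa [Lagrange.natDegree_nodal, Finset.card_erase_of_mem hx] at this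
    rw [← Lagrange.nodal_eq, h3, mul_one]
  rw [Finset.sum_congr rfl h2] at h1
  rw [Finset.sum_sub_distrib]
  simp only [id] at h1
  linarith

/-- Each `y x` lies between the node `x` and the next node of `s`. -/
def Interlaces (s : Finset ℝ) (y : ℝ → ℝ) : Prop :=
  ∀ x ∈ s, x ≤ y x ∧ ∀ x' ∈ s, x < x' → y x ≤ x'

/-- The residue is `(y x - x) * ∏ (x - y x') / (x - x')` over `x' ≠ x`, and interlacing keeps `y x'`
on the same side of `x` as `x'`. -/
lemma Interlaces.nodeResidue_nonneg {s : Finset ℝ} {y : ℝ → ℝ} (h : Interlaces s y) {x : ℝ}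
    (hx : x ∈ s) : 0 ≤ nodeResidue s y x := by
  rw [nodeResidue, ← Finset.mul_prod_erase s _ hx, ← neg_mul, mul_div_assoc,
    ← Finset.prod_div_distrib]
  refine mul_nonneg (by linarith [(h x hx).1]) (Finset.prod_nonneg fun x' hx' => ?_)
  obtain ⟨hne, hs⟩ := Finset.mem_erase.1 hx'
  rcases lt_or_gt_of_ne hne with hlt | hlt
  · exact div_nonneg (by linarith [(h x' hs).2 x hx hlt]) (by linarith)
  · exact div_nonneg_of_nonpos (by linarith [(h x' hs).1]) (by linarith)

/-- No node lies between `x` and `x'`, so for every other node `t` the factors `x - t` and `x' - t`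
have the same sign; the leftover `(x - x') * (x' - x)` is negative. -/
lemma mul_prod_sub_neg {s : Finset ℝ} {x x' : ℝ} (hx : x ∈ s) (hx' : x' ∈ s)
    (hlt : x < x') (hnext : ∀ t ∈ s, x < t → x' ≤ t) :
    (∏ t ∈ s.erase x, (x - t)) * ∏ t ∈ s.erase x', (x' - t) < 0 := by
  have h1 : x' ∈ s.erase x := Finset.mem_erase.2 ⟨hlt.ne', hx'⟩
  have h2 : x ∈ s.erase x' := Finset.mem_erase.2 ⟨hlt.ne, hx⟩
  rw [← Finset.mul_prod_erase _ _ h1, ← Finset.mul_prod_erase _ _ h2,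
    Finset.erase_right_comm (a := x'), mul_mul_mul_comm, ← Finset.prod_mul_distrib]
  refine mul_neg_of_neg_of_pos (by nlinarith) (Finset.prod_pos fun t ht => ?_)
  simp only [Finset.mem_erase] at ht
  obtain ⟨h3, h4, h5⟩ := ht
  rcases lt_or_gt_of_ne h4 with h6 | h6
  · nlinarith
  · have : x' < t := lt_of_le_of_ne (hnext t h5 h6) (Ne.symm h3)
    nlinarith

/-- The polynomial changes sign between consecutive nodes; past the last node, the sign at `x + 1`
is used. -/
lemma exists_root_secularPolynomial {s : Finset ℝ} {p : ℝ → ℝ} (hp : ∀ x ∈ s, 0 < p x)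
    (hsum : ∑ x ∈ s, p x = 1) {x : ℝ} (hx : x ∈ s) :
    ∃ y, x < y ∧ (∀ t ∈ s, x < t → y < t) ∧ (secularPolynomial s p).eval y = 0 := by
  have hQ : ∀ t ∈ s, (secularPolynomial s p).eval t ≠ 0 := fun t ht => by
    rw [eval_secularPolynomial_node p ht]
    exact neg_ne_zero.2 (mul_ne_zero (hp t ht).ne' (prod_erase_sub_ne_zero s t))
  rcases (s.filter (x < ·)).eq_empty_or_nonempty with he | hne
  · have hle : ∀ t ∈ s, t ≤ x := fun t ht => not_lt.1 fun hlt =>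
      (Finset.notMem_empty t) (he ▸ Finset.mem_filter.2 ⟨ht, hlt⟩)
    have h1 : (secularPolynomial s p).eval x ≤ 0 := by
      rw [eval_secularPolynomial_node p hx, neg_nonpos]
      refine mul_nonneg (hp x hx).le (Finset.prod_nonneg fun t ht => ?_)
      linarith [hle t (Finset.mem_of_mem_erase ht)]
    -- As `x` is the largest node, each factor `x + 1 - t` is at least `1`, so every erased product
    -- is at most the full one; the weights sum to `1`.
    have h2 : 0 ≤ (secularPolynomial s p).eval (x + 1) := by
      rw [eval_secularPolynomial, sub_nonneg]
      calc ∑ t ∈ s, p t * ∏ t' ∈ s.erase t, (x + 1 - t')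
          ≤ ∑ t ∈ s, p t * ∏ t' ∈ s, (x + 1 - t') := by
            refine Finset.sum_le_sum fun t ht => mul_le_mul_of_nonneg_left ?_ (hp t ht).le
            rw [← Finset.mul_prod_erase s _ ht]
            refine le_mul_of_one_le_left (Finset.prod_nonneg fun t' ht' => ?_) ?_
            · linarith [hle t' (Finset.mem_of_mem_erase ht')]
            · linarith [hle t ht]
        _ = _ := by rw [← Finset.sum_mul, hsum, one_mul]
    obtain ⟨y, hy, h0⟩ := intermediate_value_Icc (by linarith : x ≤ x + 1)
      (secularPolynomial s p).continuous.continuousOn ⟨h1, h2⟩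
    refine ⟨y, lt_of_le_of_ne hy.1 ?_, fun t ht hlt => absurd hlt (hle t ht).not_gt, h0⟩
    rintro rfl
    exact hQ x hx h0
  · set x' := (s.filter (x < ·)).min' hne with hx'_def
    obtain ⟨hx's, hlt⟩ := Finset.mem_filter.1 ((s.filter (x < ·)).min'_mem hne)
    have hnext : ∀ t ∈ s, x < t → x' ≤ t := fun t ht h =>
      Finset.min'_le _ _ (Finset.mem_filter.2 ⟨ht, h⟩)
    have hneg : (secularPolynomial s p).eval x * (secularPolynomial s p).eval x' < 0 := by
      rw [eval_secularPolynomial_node p hx, eval_secularPolynomial_node p hx's, neg_mul_neg,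
        mul_mul_mul_comm]
      exact mul_neg_of_pos_of_neg (mul_pos (hp _ hx) (hp _ hx's))
        (mul_prod_sub_neg hx hx's hlt hnext)
    have h0 : (0 : ℝ) ∈ Set.uIcc ((secularPolynomial s p).eval x)
        ((secularPolynomial s p).eval x') := by
      rw [Set.mem_uIcc]
      rcases mul_neg_iff.1 hneg with h | h
      · exact Or.inr ⟨h.2.le, h.1.le⟩
      · exact Or.inl ⟨h.1.le, h.2.le⟩
    obtain ⟨y, hy, hy0⟩ := intermediate_value_uIcc
      (secularPolynomial s p).continuous.continuousOn h0
    rw [Set.uIcc_of_le hlt.le] at hy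
    have h3 : y ≠ x := by
      rintro rfl
      exact hQ y hx hy0
    have h4 : y ≠ x' := by
      intro h
      exact hQ x' hx's (h ▸ hy0)
    exact ⟨y, lt_of_le_of_ne hy.1 h3.symm,
      fun t ht h => (lt_of_le_of_ne hy.2 h4).trans_le (hnext t ht h), hy0⟩

/-- The roots found are strictly separated by the nodes, hence distinct, and there are as many as
the degree. -/
lemma exists_interlaces_of_pos {s : Finset ℝ} {p : ℝ → ℝ} (hp : ∀ x ∈ s, 0 < p x)
    (hsum : ∑ x ∈ s, p x = 1) :
    ∃ y, Interlaces s y ∧ secularPolynomial s p = Lagrange.nodal s y := by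
  choose! y hy using fun x hx => exists_root_secularPolynomial (x := x) hp hsum hx
  refine ⟨y, fun x hx => ⟨(hy x hx).1.le, fun t ht h => ((hy x hx).2.1 t ht h).le⟩, ?_⟩
  have hinj : Set.InjOn y s := by
    intro a ha b hb hab
    by_contra hne
    rcases lt_or_gt_of_ne hne with h | h
    · have h1 := (hy a ha).2.1 b hb h
      have h2 := (hy b hb).1
      linarith
    · have h1 := (hy b hb).2.1 a ha h
      have h2 := (hy a ha).1
      linarith
  refine Polynomial.eq_of_degree_le_of_eval_index_eq s hinj (degree_secularPolynomial s p).le ?_ ?_ ?_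
  · rw [degree_secularPolynomial, Lagrange.degree_nodal]
  · rw [(monic_secularPolynomial s _).leadingCoeff, Lagrange.nodal_monic.leadingCoeff]
  · intro x hx
    rw [(hy x hx).2.2, Lagrange.eval_nodal_at_node hx]

lemma Interlaces.le_add_one {s : Finset ℝ} {y : ℝ → ℝ} (h : Interlaces s y)
    (hsum : ∑ x ∈ s, (y x - x) = 1) {x : ℝ} (hx : x ∈ s) : y x ≤ x + 1 := by
  have := Finset.single_le_sum (f := fun x => y x - x) (fun t ht => sub_nonneg.2 (h t ht).1) hx
  linarith

/-! ### The finite model: unions of intervals and finite sums of atoms -/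

/-- Partial fractions, written at `1 / z`. -/
lemma one_sub_sum_cauchyKernel {s : Finset ℝ} {p y : ℝ → ℝ} {z : ℂ}
    (h : secularPolynomial s p = Lagrange.nodal s y) (hz : ∀ x ∈ s, 1 - (x : ℂ) * z ≠ 0) :
    1 - ∑ x ∈ s, (p x : ℂ) * cauchyKernel z x =
      ∏ x ∈ s, (1 - (y x : ℂ) * z) / (1 - (x : ℂ) * z) := by
  rcases eq_or_ne z 0 with rfl | h0
  · simp [cauchyKernel]
  have h1 := congrArg (Polynomial.aeval z⁻¹) h
  simp only [secularPolynomial, Lagrange.nodal_eq, map_sub, map_sum, map_mul, map_prod,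
    Polynomial.aeval_X, Polynomial.aeval_C, id, Complex.coe_algebraMap] at h1
  have h2 : ∀ x ∈ s, z⁻¹ - (x : ℂ) ≠ 0 := fun x hx h => hz x hx (by
    rw [← sub_eq_zero.1 h, inv_mul_cancel₀ h0, sub_self])
  have h3 : ∀ a : ℝ, 1 - (a : ℂ) * z = z * (z⁻¹ - a) := fun a => by
    rw [mul_sub, mul_inv_cancel₀ h0, mul_comm z]
  have h4 : ∏ x ∈ s, (z⁻¹ - (x : ℂ)) ≠ 0 := Finset.prod_ne_zero_iff.2 h2
  have h5 : ∀ x ∈ s, (p x : ℂ) * cauchyKernel z x =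
      (p x : ℂ) * (∏ t ∈ s.erase x, (z⁻¹ - (t : ℂ))) / ∏ t ∈ s, (z⁻¹ - (t : ℂ)) := by
    intro x hx
    have h6 : ∏ t ∈ s.erase x, (z⁻¹ - (t : ℂ)) ≠ 0 :=
      Finset.prod_ne_zero_iff.2 fun t ht => h2 t (Finset.mem_of_mem_erase ht)
    rw [cauchyKernel, h3, ← div_div, div_self h0, ← Finset.mul_prod_erase s _ hx, mul_div_assoc,
      mul_comm (z⁻¹ - (x : ℂ)), ← div_div, div_self h6]
  simp only [h3, mul_div_mul_left _ _ h0]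
  rw [Finset.sum_congr rfl h5, ← Finset.sum_div, ← div_self h4, ← sub_div, h1,
    ← Finset.prod_div_distrib]

/-- The kernel has primitive `-log (1 - x z)`; the principal branch is legitimate because `1 - x z`
stays in the slit plane. -/
lemma exp_neg_integral_cauchyKernel_Ioc {R a b : ℝ} {z : ℂ} (ha : a ∈ Set.Icc (-R) R)
    (hb : b ∈ Set.Icc (-R) R) (hab : a ≤ b) (hz : ‖z‖ * R < 1) :
    Complex.exp (-∫ x in Set.Ioc a b, cauchyKernel z x) =
      (1 - (b : ℂ) * z) / (1 - (a : ℂ) * z) := by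
  have hsub : Set.uIcc a b ⊆ Set.Icc (-R) R := by
    rw [Set.uIcc_of_le hab]
    exact Set.Icc_subset_Icc ha.1 hb.2
  have hd : ∀ x ∈ Set.uIcc a b,
      HasDerivAt (fun x : ℝ => -Complex.log (1 - (x : ℂ) * z)) (cauchyKernel z x) x := by
    intro x hx
    have h1 : HasDerivAt (fun x : ℝ => 1 - (x : ℂ) * z) (-z) x := by
      have := ((Complex.ofRealCLM.hasDerivAt (x := x)).mul_const z).const_sub 1
      simpa using this
    have h2 := (h1.clog_real (one_sub_mul_mem_slitPlane (hsub hx) hz)).neg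
    rwa [neg_div, neg_neg] at h2
  have hi : IntervalIntegrable (cauchyKernel z) volume a b :=
    ((continuousOn_cauchyKernel hz).mono hsub).intervalIntegrable
  rw [← intervalIntegral.integral_of_le hab,
    intervalIntegral.integral_eq_sub_of_hasDerivAt hd hi, neg_sub, sub_neg_eq_add, neg_add_eq_sub,
    Complex.exp_sub, Complex.exp_log (one_sub_mul_ne_zero hb hz),
    Complex.exp_log (one_sub_mul_ne_zero ha hz)]

lemma Interlaces.pairwiseDisjoint {s : Finset ℝ} {y : ℝ → ℝ} (h : Interlaces s y) :
    Set.PairwiseDisjoint (s : Set ℝ) fun x => Set.Ioc x (y x) := by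
  intro a ha b hb hne
  rw [Function.onFun, Set.disjoint_left]
  intro t hta htb
  rcases lt_or_gt_of_ne hne with hlt | hlt
  · have := (h a ha).2 b hb hlt
    linarith [hta.2, htb.1]
  · have := (h b hb).2 a ha hlt
    linarith [hta.1, htb.2]

/-- Lebesgue measure restricted to the union of the intervals `(x, y x]`, `x ∈ s`. -/
noncomputable def intervalMeasure (s : Finset ℝ) (y : ℝ → ℝ) : Measure ℝ :=
  volume.restrict (⋃ x ∈ s, Set.Ioc x (y x))

lemma intervalMeasure_le (s : Finset ℝ) (y : ℝ → ℝ) : intervalMeasure s y ≤ volume :=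
  Measure.restrict_le_self

lemma Interlaces.isProbabilityMeasure {s : Finset ℝ} {y : ℝ → ℝ} (h : Interlaces s y)
    (hsum : ∑ x ∈ s, (y x - x) = 1) : IsProbabilityMeasure (intervalMeasure s y) := by
  constructor
  rw [intervalMeasure, Measure.restrict_apply_univ,
    measure_biUnion_finset h.pairwiseDisjoint fun _ _ => measurableSet_Ioc]
  simp only [Real.volume_Ioc]
  rw [← ENNReal.ofReal_sum_of_nonneg fun x hx => sub_nonneg.2 (h x hx).1, hsum,
    ENNReal.ofReal_one]

lemma intervalMeasure_compl_Icc {s : Finset ℝ} {y : ℝ → ℝ} {R : ℝ}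
    (hs : ∀ x ∈ s, x ∈ Set.Icc (-R) R) (hy : ∀ x ∈ s, y x ∈ Set.Icc (-R) R) :
    intervalMeasure s y (Set.Icc (-R) R)ᶜ = 0 := by
  rw [intervalMeasure, Measure.restrict_apply measurableSet_Icc.compl]
  convert measure_empty (μ := (volume : Measure ℝ))
  ext t
  simp only [Set.mem_inter_iff, Set.mem_compl_iff, Set.mem_iUnion, Set.mem_empty_iff_false,
    iff_false, not_and, not_exists]
  intro ht x hx hxt
  exact ht ⟨(hs x hx).1.trans hxt.1.le, hxt.2.trans (hy x hx).2⟩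

lemma Interlaces.integral_cauchyKernel {s : Finset ℝ} {y : ℝ → ℝ} (h : Interlaces s y) {R : ℝ}
    {z : ℂ} (hs : ∀ x ∈ s, x ∈ Set.Icc (-R) R) (hy : ∀ x ∈ s, y x ∈ Set.Icc (-R) R)
    (hz : ‖z‖ * R < 1) :
    ∫ t, cauchyKernel z t ∂intervalMeasure s y = ∑ x ∈ s, ∫ t in Set.Ioc x (y x),
      cauchyKernel z t := by
  refine integral_biUnion_finset _ (fun _ _ => measurableSet_Ioc) h.pairwiseDisjoint
    fun x hx => ?_
  refine IntegrableOn.mono_set ?_ (Set.Ioc_subset_Icc_self.trans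
    (Set.Icc_subset_Icc (hs x hx).1 (hy x hx).2))
  exact (continuousOn_cauchyKernel hz).integrableOn_Icc

lemma Interlaces.exp_neg_integral_cauchyKernel {s : Finset ℝ} {y : ℝ → ℝ} (h : Interlaces s y)
    {R : ℝ} {z : ℂ} (hs : ∀ x ∈ s, x ∈ Set.Icc (-R) R) (hy : ∀ x ∈ s, y x ∈ Set.Icc (-R) R)
    (hz : ‖z‖ * R < 1) :
    Complex.exp (-∫ t, cauchyKernel z t ∂intervalMeasure s y) =
      ∏ x ∈ s, (1 - (y x : ℂ) * z) / (1 - (x : ℂ) * z) := by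
  rw [h.integral_cauchyKernel hs hy hz, ← Finset.sum_neg_distrib, Complex.exp_sum]
  exact Finset.prod_congr rfl fun x hx =>
    exp_neg_integral_cauchyKernel_Ioc (hs x hx) (hy x hx) (h x hx).1 hz

/-- The measure `∑ p x δ_x` over `x ∈ s`. -/
noncomputable def discreteMeasure (s : Finset ℝ) (p : ℝ → ℝ) : Measure ℝ :=
  ∑ x ∈ s, ENNReal.ofReal (p x) • Measure.dirac x

lemma isProbabilityMeasure_discreteMeasure {s : Finset ℝ} {p : ℝ → ℝ} (hp : ∀ x ∈ s, 0 ≤ p x)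
    (hsum : ∑ x ∈ s, p x = 1) : IsProbabilityMeasure (discreteMeasure s p) := by
  constructor
  simp [discreteMeasure, ← ENNReal.ofReal_sum_of_nonneg hp, hsum]

lemma discreteMeasure_compl_Icc {s : Finset ℝ} (p : ℝ → ℝ) {R : ℝ}
    (hs : ∀ x ∈ s, x ∈ Set.Icc (-R) R) : discreteMeasure s p (Set.Icc (-R) R)ᶜ = 0 := by
  rw [discreteMeasure, Measure.finsetSum_apply]
  refine Finset.sum_eq_zero fun x hx => ?_
  rw [Measure.smul_apply, Measure.dirac_apply' _ measurableSet_Icc.compl,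
    Set.indicator_of_notMem (Set.notMem_compl_iff.2 (hs x hx)), smul_zero]

lemma integral_discreteMeasure {s : Finset ℝ} {p : ℝ → ℝ} (hp : ∀ x ∈ s, 0 ≤ p x) (f : ℝ → ℂ) :
    ∫ x, f x ∂discreteMeasure s p = ∑ x ∈ s, (p x : ℂ) * f x := by
  rw [discreteMeasure, integral_finsetSum_measure]
  · refine Finset.sum_congr rfl fun x hx => ?_
    rw [integral_smul_measure, integral_dirac, ENNReal.toReal_ofReal (hp x hx),
      Complex.real_smul]
  · intro x _
    exact (integrable_dirac (by simp)).smul_measure ENNReal.ofReal_ne_top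

/-! ### From bounded density to compact support -/

/-- Serves twice per cell, for `μ` and for Lebesgue measure on a shorter interval of equal mass:
both integrals are close to that mass times the kernel at the left end. -/
lemma norm_setIntegral_cauchyKernel_sub_le {ρ : Measure ℝ} {R a b : ℝ} {z : ℂ}
    (ha : a ∈ Set.Icc (-R) R) (hb : b ∈ Set.Icc (-R) R) (hz : ‖z‖ * R < 1)
    (hρ : ρ (Set.Ioc a b) < ⊤) :
    ‖(∫ t in Set.Ioc a b, cauchyKernel z t ∂ρ) - (ρ.real (Set.Ioc a b) : ℂ) * cauchyKernel z a‖ ≤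
      (‖z‖ / (1 - ‖z‖ * R)) ^ 2 * (b - a) * ρ.real (Set.Ioc a b) := by
  have hmem : ∀ t ∈ Set.Ioc a b, t ∈ Set.Icc (-R) R := fun t ht =>
    ⟨ha.1.trans ht.1.le, ht.2.trans hb.2⟩
  have hi : IntegrableOn (cauchyKernel z) (Set.Ioc a b) ρ := by
    refine Measure.integrableOn_of_bounded hρ.ne
      (measurable_cauchyKernel z).aestronglyMeasurable (M := ‖z‖ / (1 - ‖z‖ * R)) ?_
    filter_upwards [ae_restrict_mem measurableSet_Ioc] with t ht
    exact norm_cauchyKernel_le (hmem t ht) hz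
  have h1 : (ρ.real (Set.Ioc a b) : ℂ) * cauchyKernel z a =
      ∫ _ in Set.Ioc a b, cauchyKernel z a ∂ρ := by
    rw [setIntegral_const, Complex.real_smul]
  rw [h1, ← integral_sub hi (integrableOn_const hρ.ne)]
  refine norm_setIntegral_le_of_norm_le_const hρ fun t ht => ?_
  refine (norm_cauchyKernel_sub_le (hmem t ht) ha hz).trans ?_
  rw [abs_of_pos (sub_pos.2 ht.1)]
  gcongr
  exact ht.2

/-- A mesh of step `δ` carrying a measure bounded by Lebesgue measure yields a discrete measure
which is related to an approximation of the original one. -/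
lemma exists_discrete_approx {μ : Measure ℝ} [IsProbabilityMeasure μ] (hμ : μ ≤ volume)
    {s : Finset ℝ} {δ R : ℝ} (hs : Interlaces s fun x => x + δ) (hδ : 0 ≤ δ)
    (hR : ∀ x ∈ s, x ∈ Set.Icc (-R) R) (hR' : ∀ x ∈ s, x + δ ∈ Set.Icc (-R) R)
    (hcover : μ (⋃ x ∈ s, Set.Ioc x (x + δ))ᶜ = 0) :
    ∃ ν : ProbabilityMeasure ℝ, (ν : Measure ℝ) (Set.Icc (-R) R)ᶜ = 0 ∧
      ∀ z : ℂ, ‖z‖ * R < 1 → ∃ M : ℂ,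
        ‖(∫ x, cauchyKernel z x ∂μ) - M‖ ≤ 2 * (‖z‖ / (1 - ‖z‖ * R)) ^ 2 * δ ∧
        Complex.exp (-M) = 1 - ∫ x, cauchyKernel z x ∂(ν : Measure ℝ) := by
  set m : ℝ → ℝ := fun x => μ.real (Set.Ioc x (x + δ)) with hm
  -- Lebesgue measure on `(x, y x]` has the `μ`-mass of the cell, and fits into the cell because `μ
  -- ≤ volume`.
  set y : ℝ → ℝ := fun x => x + m x with hy_def
  have hmδ : ∀ x, m x ≤ δ := by
    intro x
    have := ENNReal.toReal_mono measure_Ioc_lt_top.ne (hμ (Set.Ioc x (x + δ)))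
    simpa [hm, Measure.real, hδ] using this
  have hm0 : ∀ x, 0 ≤ m x := fun x => measureReal_nonneg
  have hy : Interlaces s y := fun x hx => ⟨le_add_of_nonneg_right (hm0 x), fun x' hx' hlt =>
    (add_le_add_right (hmδ x) x).trans ((hs x hx).2 x' hx' hlt)⟩
  have hyR : ∀ x ∈ s, y x ∈ Set.Icc (-R) R := fun x hx =>
    ⟨(hR x hx).1.trans (le_add_of_nonneg_right (hm0 x)),
      (add_le_add_right (hmδ x) x).trans (hR' x hx).2⟩
  have hmeas : MeasurableSet (⋃ x ∈ s, Set.Ioc x (x + δ)) :=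
    s.measurableSet_biUnion fun _ _ => measurableSet_Ioc
  have hmsum : ∑ x ∈ s, m x = 1 := by
    rw [← measureReal_biUnion_finset hs.pairwiseDisjoint fun _ _ => measurableSet_Ioc]
    rw [Measure.real, (prob_compl_eq_zero_iff hmeas).1 hcover, ENNReal.toReal_one]
  have hysum : ∑ x ∈ s, (y x - x) = 1 := by simpa [hy_def] using hmsum
  have hp : ∀ x ∈ s, 0 ≤ nodeResidue s y x := fun x hx => hy.nodeResidue_nonneg hx
  have hpsum : ∑ x ∈ s, nodeResidue s y x = 1 := by
    rw [sum_eq_sum_sub_of_secularPolynomial_eq (secularPolynomial_nodeResidue s y), hysum]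
  refine ⟨⟨discreteMeasure s (nodeResidue s y), isProbabilityMeasure_discreteMeasure hp hpsum⟩,
    discreteMeasure_compl_Icc _ hR, fun z hz => ?_⟩
  refine ⟨∫ t, cauchyKernel z t ∂intervalMeasure s y, ?_, ?_⟩
  · have hae : ∀ᵐ t ∂μ, t ∈ ⋃ x ∈ s, Set.Ioc x (x + δ) := hcover
    have h1 : ∫ t, cauchyKernel z t ∂μ =
        ∑ x ∈ s, ∫ t in Set.Ioc x (x + δ), cauchyKernel z t ∂μ := by
      rw [← integral_biUnion_finset s (fun _ _ => measurableSet_Ioc) hs.pairwiseDisjoint,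
        Measure.restrict_eq_self_of_ae_mem hae]
      intro x hx
      refine (integrable_cauchyKernel (R := R) ?_ hz).integrableOn
      refine measure_mono_null (Set.compl_subset_compl.2 ?_) hcover
      refine Set.iUnion₂_subset fun x hx t ht => ?_
      exact ⟨(hR x hx).1.trans ht.1.le, ht.2.trans (hR' x hx).2⟩
    rw [h1, hy.integral_cauchyKernel hR hyR hz, ← Finset.sum_sub_distrib]
    have hb : ∀ x ∈ s, ‖(∫ t in Set.Ioc x (x + δ), cauchyKernel z t ∂μ) -
        ∫ t in Set.Ioc x (y x), cauchyKernel z t‖ ≤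
        (2 * (‖z‖ / (1 - ‖z‖ * R)) ^ 2 * δ) * m x := by
      intro x hx
      have h2 := norm_setIntegral_cauchyKernel_sub_le (ρ := μ) (hR x hx) (hR' x hx) hz
        (measure_lt_top _ _)
      have h3 := norm_setIntegral_cauchyKernel_sub_le (ρ := volume) (hR x hx) (hyR x hx) hz
        measure_Ioc_lt_top
      have h4 : volume.real (Set.Ioc x (y x)) = m x := by
        rw [Real.volume_real_Ioc_of_le (hy x hx).1]
        simp [hy_def]
      rw [h4] at h3
      rw [norm_sub_rev] at h3
      have h5 := norm_sub_le_norm_sub_add_norm_sub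
        (∫ t in Set.Ioc x (x + δ), cauchyKernel z t ∂μ) ((m x : ℂ) * cauchyKernel z x)
        (∫ t in Set.Ioc x (y x), cauchyKernel z t)
      have h6 : (‖z‖ / (1 - ‖z‖ * R)) ^ 2 * (y x - x) * m x ≤
          (‖z‖ / (1 - ‖z‖ * R)) ^ 2 * δ * m x := by
        have : y x - x ≤ δ := by simpa [hy_def] using hmδ x
        have := hm0 x
        gcongr
      have h7 : x + δ - x = δ := by ring
      rw [h7] at h2
      change ‖(∫ t in Set.Ioc x (x + δ), cauchyKernel z t ∂μ) - (m x : ℂ) * cauchyKernel z x‖ ≤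
        (‖z‖ / (1 - ‖z‖ * R)) ^ 2 * δ * m x at h2
      linarith
    refine (norm_sum_le_of_le s hb).trans ?_
    rw [← Finset.mul_sum, hmsum, mul_one]
  · rw [hy.exp_neg_integral_cauchyKernel hR hyR hz]
    rw [← one_sub_sum_cauchyKernel (secularPolynomial_nodeResidue s y)
      fun x hx => one_sub_mul_ne_zero (hR x hx) hz]
    rw [ProbabilityMeasure.coe_mk, integral_discreteMeasure hp]

/-- The left end points of the cells of length `1 / m` which tile `(-N, N]`. -/
noncomputable def gridPoints (N m : ℕ) : Finset ℝ :=
  (Finset.Ico (-(N * m : ℤ)) (N * m)).image fun i : ℤ => (i : ℝ) / m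

lemma interlaces_gridPoints {N m : ℕ} (hm : 0 < m) :
    Interlaces (gridPoints N m) fun x => x + 1 / m := by
  have hm' : (0 : ℝ) < m := by exact_mod_cast hm
  intro x hx
  refine ⟨le_add_of_nonneg_right (by positivity), fun x' hx' hlt => ?_⟩
  obtain ⟨i, -, rfl⟩ := Finset.mem_image.1 hx
  obtain ⟨j, -, rfl⟩ := Finset.mem_image.1 hx'
  rw [div_lt_div_iff_of_pos_right hm', Int.cast_lt] at hlt
  change (i : ℝ) / m + 1 / m ≤ j / m
  rw [← add_div, div_le_div_iff_of_pos_right hm']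
  exact_mod_cast hlt

lemma gridPoints_mem {N m : ℕ} (hm : 0 < m) {x : ℝ} (hx : x ∈ gridPoints N m) :
    -(N : ℝ) ≤ x ∧ x + 1 / m ≤ N := by
  have hm' : (0 : ℝ) < m := by exact_mod_cast hm
  obtain ⟨i, hi, rfl⟩ := Finset.mem_image.1 hx
  obtain ⟨h1, h2⟩ := Finset.mem_Ico.1 hi
  rw [← add_div, le_div_iff₀ hm', div_le_iff₀ hm']
  have h3 : i + 1 ≤ N * m := h2
  constructor
  · rw [neg_mul]
    exact_mod_cast h1
  · exact_mod_cast h3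

lemma Ioc_subset_iUnion_gridPoints {N m : ℕ} (hm : 0 < m) :
    Set.Ioc (-(N : ℝ)) N ⊆ ⋃ x ∈ gridPoints N m, Set.Ioc x (x + 1 / m) := by
  have hm' : (0 : ℝ) < m := by exact_mod_cast hm
  intro t ht
  have h1 : ((⌈t * m⌉ : ℤ) : ℝ) < t * m + 1 := Int.ceil_lt_add_one _
  have h2 : t * m ≤ (⌈t * m⌉ : ℤ) := Int.le_ceil _
  simp only [Set.mem_iUnion]
  -- Cells are open on the left, hence `⌈t * m⌉ - 1` rather than a floor.
  refine ⟨((⌈t * m⌉ - 1 : ℤ) : ℝ) / m, Finset.mem_image.2 ⟨_, Finset.mem_Ico.2 ⟨?_, ?_⟩, rfl⟩, ?_, ?_⟩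
  · have h3 : (-(N * m : ℤ)) < ⌈t * m⌉ := by
      rw [Int.lt_ceil]
      push_cast
      nlinarith [ht.1]
    omega
  · have h3 : ⌈t * m⌉ ≤ (N * m : ℤ) := by
      rw [Int.ceil_le]
      push_cast
      exact mul_le_mul_of_nonneg_right ht.2 hm'.le
    omega
  · rw [div_lt_iff₀ hm']
    push_cast
    linarith
  · rw [← add_div, le_div_iff₀ hm']
    push_cast
    linarith

lemma exists_compact_of_le_volume (μ : ProbabilityMeasure ℝ) (hμ : (μ : Measure ℝ) ≤ volume)
    {R : ℝ} (hR : (μ : Measure ℝ) (Set.Icc (-R) R)ᶜ = 0) :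
    ∃ (N : ℕ) (ν : ProbabilityMeasure ℝ), (ν : Measure ℝ) (Set.Icc (-(N : ℝ)) N)ᶜ = 0 ∧
      ∀ z : ℂ, ‖z‖ * N < 1 → Complex.exp (-∫ x, cauchyKernel z x ∂(μ : Measure ℝ)) =
        1 - ∫ x, cauchyKernel z x ∂(ν : Measure ℝ) := by
  -- Strictness puts the end point `-R` inside the left-open `(-N, N]`.
  obtain ⟨N, hN⟩ := exists_nat_gt R
  have hcover : ∀ n : ℕ, (μ : Measure ℝ)
      (⋃ x ∈ gridPoints N (n + 1), Set.Ioc x (x + 1 / ((n + 1 : ℕ) : ℝ)))ᶜ = 0 := fun n => by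
    refine measure_mono_null (Set.compl_subset_compl.2 ?_) hR
    refine Set.Subset.trans (fun t ht => ?_) (Ioc_subset_iUnion_gridPoints n.succ_pos)
    exact ⟨by linarith [ht.1], by linarith [ht.2]⟩
  have hex := fun n : ℕ => exists_discrete_approx (μ := (μ : Measure ℝ)) hμ (R := N)
    (interlaces_gridPoints (N := N) n.succ_pos) (by positivity)
    (fun x hx => ⟨(gridPoints_mem n.succ_pos hx).1,
      (le_add_of_nonneg_right (by positivity)).trans (gridPoints_mem n.succ_pos hx).2⟩)
    (fun x hx => ⟨(gridPoints_mem n.succ_pos hx).1.trans (le_add_of_nonneg_right (by positivity)),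
      (gridPoints_mem n.succ_pos hx).2⟩) (hcover n)
  choose ν hν hM using hex
  obtain ⟨U, σ, hU, hσ, hlim⟩ := exists_ultrafilter_tendsto ν hν
  refine ⟨N, σ, hσ, fun z hz => ?_⟩
  choose M hM1 hM2 using fun n => hM n z hz
  have h1 := tendsto_integral_cauchyKernel (Nat.cast_nonneg N) hz hν hσ hlim
  have h2 : Tendsto M atTop (𝓝 (∫ x, cauchyKernel z x ∂(μ : Measure ℝ))) := by
    rw [tendsto_iff_norm_sub_tendsto_zero]
    refine squeeze_zero (fun _ => norm_nonneg _) (fun n => (norm_sub_rev _ _).trans_le (hM1 n)) ?_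
    have := (tendsto_one_div_add_atTop_nhds_zero_nat (𝕜 := ℝ)).const_mul
      (2 * (‖z‖ / (1 - ‖z‖ * N)) ^ 2)
    simpa using this
  have h3 := (Complex.continuous_exp.tendsto _).comp (h2.mono_left hU).neg
  refine tendsto_nhds_unique h3 ?_
  refine (h1.const_sub 1).congr fun n => ?_
  exact (hM2 n).symm

/-! ### From compact support to bounded density -/

/-- Portmanteau on open sets, extended to all sets by outer regularity of Lebesgue measure. -/
lemma le_volume_of_tendsto {ι : Type*} {L : Filter ι} [L.NeBot] {ρ : ι → ProbabilityMeasure ℝ}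
    {σ : ProbabilityMeasure ℝ} (h : Tendsto ρ L (𝓝 σ)) (hρ : ∀ i, (ρ i : Measure ℝ) ≤ volume) :
    (σ : Measure ℝ) ≤ volume := by
  refine Measure.le_intro fun A _ _ => ?_
  rw [A.measure_eq_iInf_isOpen volume]
  refine le_iInf₂ fun V hAV => le_iInf fun hV => (measure_mono hAV).trans ?_
  refine (ProbabilityMeasure.le_liminf_measure_open_of_tendsto h hV).trans ?_
  exact liminf_le_of_le (by isBoundedDefault) fun b hb => by
    obtain ⟨i, hi⟩ := hb.exists
    exact hi.trans (hρ i V)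

lemma exists_interval_measure {ν : Measure ℝ} [IsProbabilityMeasure ν] (f : SimpleFunc ℝ ℝ)
    {R : ℝ} (hf : ∀ x, f x ∈ Set.Icc (-R) R) :
    ∃ μ : ProbabilityMeasure ℝ, (μ : Measure ℝ) ≤ volume ∧
      (μ : Measure ℝ) (Set.Icc (-(R + 1)) (R + 1))ᶜ = 0 ∧
      ∀ z : ℂ, ‖z‖ * (R + 1) < 1 →
        Complex.exp (-∫ x, cauchyKernel z x ∂(μ : Measure ℝ)) =
          1 - ∫ x, cauchyKernel z (f x) ∂ν := by
  set p : ℝ → ℝ := fun x => ν.real (f ⁻¹' {x}) with hp_def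
  -- Null atoms are dropped: the strict separation of roots needs positive weights.
  set s : Finset ℝ := f.range.filter (fun x => 0 < p x) with hs_def
  have hp : ∀ x ∈ s, 0 < p x := fun x hx => (Finset.mem_filter.1 hx).2
  have hint : ∀ g : ℝ → ℂ, ∫ x, g (f x) ∂ν = ∑ x ∈ s, (p x : ℂ) * g x := by
    intro g
    have hU : (⋃ x ∈ f.range, f ⁻¹' {x}) = Set.univ := by
      refine Set.eq_univ_of_forall fun t => ?_
      simp only [Set.mem_iUnion]
      exact ⟨f t, f.mem_range_self t, rfl⟩
    have hd : Set.PairwiseDisjoint (f.range : Set ℝ) fun x => f ⁻¹' {x} := fun a _ b _ hab =>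
      (Set.disjoint_singleton.2 hab).preimage f
    have hc : ∀ x, ∫ t in f ⁻¹' {x}, g (f t) ∂ν = (p x : ℂ) * g x := fun x => by
      have : ∫ t in f ⁻¹' {x}, g (f t) ∂ν = ∫ t in f ⁻¹' {x}, g x ∂ν :=
        setIntegral_congr_fun (f.measurableSet_fiber x) fun t ht => congrArg g ht
      rw [this, setIntegral_const, Complex.real_smul]
    have hi : Integrable (fun t => g (f t)) ν := (f.map g).integrable_of_isFiniteMeasure
    rw [← setIntegral_univ, ← hU, integral_biUnion_finset _ (fun x _ => f.measurableSet_fiber x) hd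
      fun x _ => hi.integrableOn, hs_def, Finset.sum_filter_of_ne]
    · exact Finset.sum_congr rfl fun x _ => hc x
    · intro x _ hne
      refine lt_of_le_of_ne measureReal_nonneg fun h => hne ?_
      rw [← h, Complex.ofReal_zero, zero_mul]
  have hsum : ∑ x ∈ s, p x = 1 := by
    have := hint fun _ => 1
    simp only [integral_const, probReal_univ, one_smul, mul_one] at this
    exact_mod_cast this.symm
  have hsR : ∀ x ∈ s, x ∈ Set.Icc (-R) R := by
    intro x hx
    obtain ⟨t, rfl⟩ := SimpleFunc.mem_range.1 (Finset.mem_filter.1 hx).1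
    exact hf t
  obtain ⟨y, hy, hsec⟩ := exists_interlaces_of_pos hp hsum
  have hysum : ∑ x ∈ s, (y x - x) = 1 := by
    rw [← sum_eq_sum_sub_of_secularPolynomial_eq hsec, hsum]
  have hsR' : ∀ x ∈ s, x ∈ Set.Icc (-(R + 1)) (R + 1) := fun x hx =>
    ⟨by linarith [(hsR x hx).1], by linarith [(hsR x hx).2]⟩
  -- The interval lengths sum to `1`, so no `y x` exceeds `x + 1`; the bound does not depend on `f`,
  -- which the later compactness argument needs.
  have hyR : ∀ x ∈ s, y x ∈ Set.Icc (-(R + 1)) (R + 1) := fun x hx =>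
    ⟨(hsR' x hx).1.trans (hy x hx).1,
      (hy.le_add_one hysum hx).trans (by linarith [(hsR x hx).2])⟩
  refine ⟨⟨intervalMeasure s y, hy.isProbabilityMeasure hysum⟩, intervalMeasure_le s y,
    intervalMeasure_compl_Icc hsR' hyR, fun z hz => ?_⟩
  rw [ProbabilityMeasure.coe_mk, hy.exp_neg_integral_cauchyKernel hsR' hyR hz, hint,
    one_sub_sum_cauchyKernel hsec fun x hx => one_sub_mul_ne_zero (hsR' x hx) hz]

lemma exists_le_volume_of_compact (ν : ProbabilityMeasure ℝ) {R : ℝ} (hR0 : 0 ≤ R)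
    (hR : (ν : Measure ℝ) (Set.Icc (-R) R)ᶜ = 0) :
    ∃ μ : ProbabilityMeasure ℝ, (μ : Measure ℝ) ≤ volume ∧
      (μ : Measure ℝ) (Set.Icc (-(R + 1)) (R + 1))ᶜ = 0 ∧
      ∀ z : ℂ, ‖z‖ * (R + 1) < 1 → Complex.exp (-∫ x, cauchyKernel z x ∂(μ : Measure ℝ)) =
        1 - ∫ x, cauchyKernel z x ∂(ν : Measure ℝ) := by
  have h0 : (0 : ℝ) ∈ Set.Icc (-R) R := ⟨by linarith, hR0⟩
  let f : ℕ → SimpleFunc ℝ ℝ := SimpleFunc.approxOn id measurable_id (Set.Icc (-R) R) 0 h0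
  have hf : ∀ n x, f n x ∈ Set.Icc (-R) R := fun n x => SimpleFunc.approxOn_mem _ h0 n x
  choose μ hμ hμR hexp using fun n => exists_interval_measure (ν := (ν : Measure ℝ)) (f n) (hf n)
  obtain ⟨U, σ, hU, hσ, hlim⟩ := exists_ultrafilter_tendsto μ hμR
  refine ⟨σ, le_volume_of_tendsto hlim hμ, hσ, fun z hz => ?_⟩
  have hz' : ‖z‖ * R < 1 := by nlinarith [norm_nonneg z]
  have h1 := tendsto_integral_cauchyKernel (by linarith) hz hμR hσ hlim
  have h2 : Tendsto (fun n => ∫ x, cauchyKernel z (f n x) ∂(ν : Measure ℝ)) atTop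
      (𝓝 (∫ x, cauchyKernel z x ∂(ν : Measure ℝ))) := by
    refine tendsto_integral_of_dominated_convergence (fun _ => ‖z‖ / (1 - ‖z‖ * R))
      (fun n => ((measurable_cauchyKernel z).comp (f n).measurable).aestronglyMeasurable)
      (integrable_const _) (fun n => ae_of_all _ fun x => norm_cauchyKernel_le (hf n x) hz') ?_
    filter_upwards [ae_mem_Icc hR] with x hx
    have hx' := SimpleFunc.tendsto_approxOn measurable_id h0 (x := x) (subset_closure hx)
    refine ((continuousOn_cauchyKernel hz' x hx).tendsto).comp ?_
    exact tendsto_nhdsWithin_iff.2 ⟨hx', Eventually.of_forall fun n => hf n x⟩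
  have h3 := (Complex.continuous_exp.tendsto _).comp h1.neg
  refine tendsto_nhds_unique h3 (((h2.mono_left hU).const_sub 1).congr fun n => ?_)
  exact (hexp n z hz).symm

/-! ### Uniqueness from germs at zero -/

lemma eventually_norm_mul_lt_one (R : ℝ) : ∀ᶠ z : ℂ in 𝓝 0, ‖z‖ * R < 1 := by
  have h : Tendsto (fun z : ℂ => ‖z‖ * R) (𝓝 0) (𝓝 (‖(0 : ℂ)‖ * R)) :=
    Continuous.tendsto (by fun_prop) 0
  rw [norm_zero, zero_mul] at h
  exact h.eventually_lt_const one_pos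

lemma tendsto_integral_cauchyKernel_zero {ρ : Measure ℝ} [IsFiniteMeasure ρ] {R : ℝ}
    (hρ : ρ (Set.Icc (-R) R)ᶜ = 0) :
    Tendsto (fun z => ∫ x, cauchyKernel z x ∂ρ) (𝓝 0) (𝓝 0) := by
  have h : Tendsto (fun z : ℂ => ‖z‖ / (1 - ‖z‖ * R) * ρ.real Set.univ) (𝓝 0) (𝓝 0) := by
    have h1 : ContinuousAt (fun z : ℂ => ‖z‖ / (1 - ‖z‖ * R) * ρ.real Set.univ) 0 :=
      ContinuousAt.mul (ContinuousAt.div (by fun_prop) (by fun_prop) (by simp)) continuousAt_const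
    simpa [ContinuousAt] using h1
  refine squeeze_zero_norm' ?_ h
  filter_upwards [eventually_norm_mul_lt_one R] with z hz
  refine norm_integral_le_of_norm_le_const ?_
  filter_upwards [ae_mem_Icc hρ] with x hx using norm_cauchyKernel_le hx hz

/-- The Taylor coefficients at `0` of `z ↦ ∫ z / (1 - x z)`. -/
noncomputable def momentCoeff (ρ : Measure ℝ) : ℕ → ℂ
  | 0 => 0
  | k + 1 => ((moment id k ρ : ℝ) : ℂ)

lemma hasFPowerSeriesAt_integral_cauchyKernel {ρ : Measure ℝ} [IsFiniteMeasure ρ] {R : ℝ}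
    (hR : 0 ≤ R) (hρ : ρ (Set.Icc (-R) R)ᶜ = 0) :
    HasFPowerSeriesAt (fun z => ∫ x, cauchyKernel z x ∂ρ)
      (FormalMultilinearSeries.ofScalars ℂ (momentCoeff ρ)) 0 := by
  rw [hasFPowerSeriesAt_iff]
  filter_upwards [eventually_norm_mul_lt_one R] with z hz
  have h := hasSum_momentTerm hR hρ hz
  rw [zero_add, ← hasSum_nat_add_iff' 1]
  simp only [FormalMultilinearSeries.coeff_ofScalars, smul_eq_mul, Finset.sum_range_one,
    momentCoeff, mul_comm (z ^ _)]
  rw [zero_mul, sub_zero]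
  exact h

lemma hasSum_charFun {ρ : Measure ℝ} [IsFiniteMeasure ρ] {R : ℝ}
    (hρ : ρ (Set.Icc (-R) R)ᶜ = 0) (t : ℝ) :
    HasSum (fun k : ℕ => ((t : ℂ) * Complex.I) ^ k / (k.factorial : ℂ) *
      ((moment id k ρ : ℝ) : ℂ)) (charFun ρ t) := by
  let F : ℕ → ℝ → ℂ := fun k x => ((t : ℂ) * Complex.I) ^ k / (k.factorial : ℂ) * (x : ℂ) ^ k
  have hb : ∀ k, ∀ᵐ x ∂ρ, ‖F k x‖ ≤ (|t| * R) ^ k / (k.factorial : ℝ) := fun k => by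
    filter_upwards [ae_mem_Icc hρ] with x hx
    have := abs_le.2 hx
    simp only [F, norm_mul, norm_div, norm_pow, Complex.norm_real, Real.norm_eq_abs,
      Complex.norm_I, mul_one, RCLike.norm_natCast]
    rw [mul_pow, div_mul_eq_mul_div]
    gcongr
  have hint : ∀ k, Integrable (F k) ρ := fun k => Integrable.of_bound (by fun_prop) _ (hb k)
  have hs : Summable fun k => ∫ x, ‖F k x‖ ∂ρ := by
    refine Summable.of_nonneg_of_le (fun k => integral_nonneg fun x => norm_nonneg _)
      (fun k => ?_) ((Real.summable_pow_div_factorial (|t| * R)).mul_left (ρ.real Set.univ))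
    calc _ ≤ ∫ _, (|t| * R) ^ k / (k.factorial : ℝ) ∂ρ :=
          integral_mono_ae (hint k).norm (integrable_const _) (hb k)
      _ = _ := by simp
  have key := hasSum_integral_of_summable_integral_norm hint hs
  have h1 : ∀ k, ∫ x, F k x ∂ρ = ((t : ℂ) * Complex.I) ^ k / (k.factorial : ℂ) *
      ((moment id k ρ : ℝ) : ℂ) := fun k => by
    rw [integral_const_mul, moment, ← integral_complex_ofReal]
    simp
  have h2 : ∀ x, ∑' k, F k x = Complex.exp (t * x * Complex.I) := fun x => by
    rw [Complex.exp_eq_exp_ℂ, NormedSpace.exp_eq_tsum_div]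
    refine tsum_congr fun k => ?_
    simp only [F]
    ring
  simp only [h1, h2] at key
  rwa [charFun_apply_real]

/-- For bounded support the characteristic function is the everywhere convergent power series built
from the moments. -/
lemma measure_eq_of_moment_eq {ρ σ : Measure ℝ} [IsFiniteMeasure ρ] [IsFiniteMeasure σ] {R S : ℝ}
    (hρ : ρ (Set.Icc (-R) R)ᶜ = 0) (hσ : σ (Set.Icc (-S) S)ᶜ = 0)
    (h : ∀ k, moment id k ρ = moment id k σ) : ρ = σ := by
  refine Measure.ext_of_charFun (funext fun t => ?_)
  have h1 := hasSum_charFun hρ t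
  simp only [h] at h1
  exact h1.unique (hasSum_charFun hσ t)

lemma measure_eq_of_integral_cauchyKernel_eq {ρ σ : Measure ℝ} [IsFiniteMeasure ρ]
    [IsFiniteMeasure σ] {R S : ℝ} (hR : 0 ≤ R) (hS : 0 ≤ S) (hρ : ρ (Set.Icc (-R) R)ᶜ = 0)
    (hσ : σ (Set.Icc (-S) S)ᶜ = 0)
    (h : ∀ᶠ z in 𝓝 (0 : ℂ), ∫ x, cauchyKernel z x ∂ρ = ∫ x, cauchyKernel z x ∂σ) : ρ = σ := by
  refine measure_eq_of_moment_eq hρ hσ fun k => ?_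
  have h1 := ((hasFPowerSeriesAt_integral_cauchyKernel hR hρ).congr h).eq_formalMultilinearSeries
    (hasFPowerSeriesAt_integral_cauchyKernel hS hσ)
  have h2 := congrArg (fun p => p.coeff (k + 1)) h1
  simpa [FormalMultilinearSeries.coeff_ofScalars, momentCoeff] using h2

lemma markovKreinRel_iff {q : ℝ} {μ ν : Measure ℝ} [IsFiniteMeasure μ] [IsFiniteMeasure ν]
    {R S : ℝ} (hR : 0 ≤ R) (hS : 0 ≤ S) (hμ : μ (Set.Icc (-R) R)ᶜ = 0)
    (hν : ν (Set.Icc (-S) S)ᶜ = 0) :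
    MarkovKreinRel q μ ν ↔ ∀ᶠ z in 𝓝 (0 : ℂ),
      Complex.exp (-(q : ℂ) * ∫ x, cauchyKernel z x ∂μ) =
        1 - (q : ℂ) * ∫ x, cauchyKernel z x ∂ν := by
  refine eventually_congr ?_
  filter_upwards [eventually_norm_mul_lt_one R, eventually_norm_mul_lt_one S] with z hz hz'
  have h1 := hasSum_momentTerm hR hμ hz
  have h2 := hasSum_momentTerm hS hν hz'
  rw [h1.tsum_eq, h2.tsum_eq]
  exact ⟨fun h => h.2.2, fun h => ⟨h1.summable, h2.summable, h⟩⟩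

lemma MarkovKreinRel.right_unique {q : ℝ} (hq : q ≠ 0) {μ ν ν' : Measure ℝ} [IsFiniteMeasure μ]
    [IsFiniteMeasure ν] [IsFiniteMeasure ν'] {R S S' : ℝ} (hR : 0 ≤ R) (hS : 0 ≤ S)
    (hS' : 0 ≤ S') (hμ : μ (Set.Icc (-R) R)ᶜ = 0) (hν : ν (Set.Icc (-S) S)ᶜ = 0)
    (hν' : ν' (Set.Icc (-S') S')ᶜ = 0) (h : MarkovKreinRel q μ ν) (h' : MarkovKreinRel q μ ν') :
    ν = ν' := by
  rw [markovKreinRel_iff hR hS hμ hν] at h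
  rw [markovKreinRel_iff hR hS' hμ hν'] at h'
  refine measure_eq_of_integral_cauchyKernel_eq hS hS' hν hν' ?_
  filter_upwards [h, h'] with z h1 h2
  exact mul_left_cancel₀ (Complex.ofReal_ne_zero.2 hq) (sub_right_injective (h1.symm.trans h2))

/-- Near `0` the exponent is small, so its imaginary part lies within `(-π, π)`. -/
lemma eventually_log_exp_integral_cauchyKernel (q : ℝ) {ρ : Measure ℝ} [IsFiniteMeasure ρ] {R : ℝ}
    (hρ : ρ (Set.Icc (-R) R)ᶜ = 0) : ∀ᶠ z in 𝓝 (0 : ℂ),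
      Complex.log (Complex.exp (-(q : ℂ) * ∫ x, cauchyKernel z x ∂ρ)) =
        -(q : ℂ) * ∫ x, cauchyKernel z x ∂ρ := by
  have h1 := (tendsto_integral_cauchyKernel_zero hρ).const_mul (-(q : ℂ))
  rw [mul_zero] at h1
  have h2 := (Complex.continuous_im.tendsto 0).comp h1
  rw [Complex.zero_im] at h2
  filter_upwards [h2.eventually_lt_const Real.pi_pos,
    h2.eventually_const_lt (neg_lt_zero.2 Real.pi_pos)] with z h3 h4
  exact Complex.log_exp h4 h3.le

lemma MarkovKreinRel.left_unique {q : ℝ} (hq : q ≠ 0) {μ μ' ν : Measure ℝ} [IsFiniteMeasure μ]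
    [IsFiniteMeasure μ'] [IsFiniteMeasure ν] {R R' S : ℝ} (hR : 0 ≤ R) (hR' : 0 ≤ R')
    (hS : 0 ≤ S) (hμ : μ (Set.Icc (-R) R)ᶜ = 0) (hμ' : μ' (Set.Icc (-R') R')ᶜ = 0)
    (hν : ν (Set.Icc (-S) S)ᶜ = 0) (h : MarkovKreinRel q μ ν) (h' : MarkovKreinRel q μ' ν) :
    μ = μ' := by
  rw [markovKreinRel_iff hR hS hμ hν] at h
  rw [markovKreinRel_iff hR' hS hμ' hν] at h'
  refine measure_eq_of_integral_cauchyKernel_eq hR hR' hμ hμ' ?_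
  filter_upwards [h, h', eventually_log_exp_integral_cauchyKernel q hμ,
    eventually_log_exp_integral_cauchyKernel q hμ'] with z h1 h2 h3 h4
  refine mul_left_cancel₀ (neg_ne_zero.2 (Complex.ofReal_ne_zero.2 hq)) ?_
  rw [← h3, ← h4, h1, h2]

/-! ### Dilation and the density bound -/

lemma mul_integral_cauchyKernel_map (c : ℝ) (ρ : Measure ℝ) (z : ℂ) :
    (c : ℂ) * ∫ x, cauchyKernel z x ∂(ρ.map (c * ·)) = ∫ x, cauchyKernel (c * z) x ∂ρ := by
  rw [integral_map (by fun_prop) (measurable_cauchyKernel z).aestronglyMeasurable,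
    ← integral_const_mul]
  refine integral_congr_ae (ae_of_all _ fun x => ?_)
  simp only [cauchyKernel, mul_div_assoc', Complex.ofReal_mul]
  ring_nf

lemma map_mul_compl_Icc {ρ : Measure ℝ} {R : ℝ} (c : ℝ) (hρ : ρ (Set.Icc (-R) R)ᶜ = 0) :
    ρ.map (c * ·) (Set.Icc (-(|c| * R)) (|c| * R))ᶜ = 0 := by
  rw [Measure.map_apply (by fun_prop) measurableSet_Icc.compl]
  refine measure_mono_null (fun x hx => ?_) hρ
  refine fun hxR => hx (abs_le.1 ?_)
  rw [abs_mul]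
  exact mul_le_mul_of_nonneg_left (abs_le.2 hxR) (abs_nonneg c)

lemma map_mul_volume_le {q : ℝ} (hq : q ≠ 0) {μ : Measure ℝ} (hμ : μ ≤ volume) :
    μ.map (q * ·) ≤ ENNReal.ofReal (1 / |q|) • (volume : Measure ℝ) := by
  refine (Measure.map_mono hμ (by fun_prop)).trans ?_
  rw [Real.map_volume_mul_left hq, abs_inv, one_div]

lemma map_inv_mul_le_volume {q : ℝ} (hq : q ≠ 0) {μ : Measure ℝ}
    (hμ : μ ≤ ENNReal.ofReal (1 / |q|) • (volume : Measure ℝ)) :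
    μ.map (q⁻¹ * ·) ≤ volume := by
  refine (Measure.map_mono hμ (by fun_prop)).trans ?_
  rw [Measure.map_smul, Real.map_volume_mul_left (inv_ne_zero hq), inv_inv, smul_smul,
    ← ENNReal.ofReal_mul (by positivity), one_div, inv_mul_cancel₀ (abs_ne_zero.2 hq),
    ENNReal.ofReal_one, one_smul]

lemma le_smul_volume_of_rnDeriv_le {μ : Measure ℝ} [IsFiniteMeasure μ] {c : ENNReal}
    (hac : μ ≪ volume) (h : ∀ᵐ x, μ.rnDeriv volume x ≤ c) : μ ≤ c • (volume : Measure ℝ) := by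
  rw [← Measure.withDensity_rnDeriv_eq μ volume hac, ← withDensity_const]
  exact withDensity_mono h

lemma rnDeriv_le_of_le_smul_volume {μ : Measure ℝ} {c : ENNReal}
    (h : μ ≤ c • (volume : Measure ℝ)) : ∀ᵐ x, μ.rnDeriv volume x ≤ c := by
  refine ae_le_of_forall_setLIntegral_le_of_sigmaFinite (Measure.measurable_rnDeriv _ _)
    fun s _ _ => ?_
  refine (Measure.setLIntegral_rnDeriv_le s).trans ((h s).trans ?_)
  simp

lemma exists_measure_compl_Icc_eq_zero {ρ : Measure ℝ} (h : IsCompact ρ.support) :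
    ∃ R, 0 ≤ R ∧ ρ (Set.Icc (-R) R)ᶜ = 0 := by
  obtain ⟨R, hR, hsub⟩ := h.isBounded.subset_closedBall_lt 0 0
  rw [Real.closedBall_eq_Icc, zero_sub, zero_add] at hsub
  exact ⟨R, hR.le, measure_mono_null (Set.compl_subset_compl.2 hsub)
    Measure.measure_compl_support⟩

lemma isCompact_support_of_compl_Icc {ρ : Measure ℝ} {R : ℝ} (h : ρ (Set.Icc (-R) R)ᶜ = 0) :
    IsCompact ρ.support :=
  isCompact_Icc.of_isClosed_subset Measure.isClosed_support
    (Measure.support_subset_of_isClosed isClosed_Icc h)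

/-- The dilations enter only through integral identities, so that both directions can use it: in
one, `μ'` is the image of `μ` under `q⁻¹` and `ν` that of `ν'` under `q`; in the other, the roles
are exchanged. -/
lemma markovKreinRel_of_dilation {q : ℝ} {μ μ' ν ν' : Measure ℝ}
    [IsFiniteMeasure μ] [IsFiniteMeasure ν] {R S T : ℝ}
    (hR : 0 ≤ R) (hS : 0 ≤ S) (hμ : μ (Set.Icc (-R) R)ᶜ = 0) (hν : ν (Set.Icc (-S) S)ᶜ = 0)
    (hμ' : ∀ z, (q : ℂ) * ∫ x, cauchyKernel z x ∂μ = ∫ x, cauchyKernel (q * z) x ∂μ')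
    (hν' : ∀ z, (q : ℂ) * ∫ x, cauchyKernel z x ∂ν = ∫ x, cauchyKernel (q * z) x ∂ν')
    (h : ∀ z : ℂ, ‖z‖ * T < 1 → Complex.exp (-∫ x, cauchyKernel z x ∂μ') =
      1 - ∫ x, cauchyKernel z x ∂ν') : MarkovKreinRel q μ ν := by
  rw [markovKreinRel_iff hR hS hμ hν]
  filter_upwards [eventually_norm_mul_lt_one (|q| * T)] with z hz
  rw [neg_mul, hμ', hν']
  refine h _ ?_
  rw [norm_mul, Complex.norm_real, Real.norm_eq_abs]
  linarith

lemma mul_integral_cauchyKernel_eq {q : ℝ} (hq : q ≠ 0) (ρ : Measure ℝ) (z : ℂ) :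
    (q : ℂ) * ∫ x, cauchyKernel z x ∂ρ = ∫ x, cauchyKernel (q * z) x ∂(ρ.map (q⁻¹ * ·)) := by
  have hq' := Complex.ofReal_ne_zero.2 hq
  have h := mul_integral_cauchyKernel_map q⁻¹ ρ (q * z)
  rw [Complex.ofReal_inv, inv_mul_cancel_left₀ hq'] at h
  rw [← h, mul_inv_cancel_left₀ hq']

/-! ### The bijection -/

instance (ν : CompactProb) : IsProbabilityMeasure ν.toMeasure :=
  inferInstanceAs (IsProbabilityMeasure (ν.1 : Measure ℝ))

instance {q : ℝ} (μ : BoundedDensityProb q) : IsProbabilityMeasure μ.toMeasure :=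
  inferInstanceAs (IsProbabilityMeasure (μ.1 : Measure ℝ))

lemma BoundedDensityProb.exists_markovKreinRel {q : ℝ} (hq : q ≠ 0) (μ : BoundedDensityProb q) :
    ∃ ν : CompactProb, MarkovKreinRel q μ.toMeasure ν.toMeasure := by
  obtain ⟨μ, hc, hac, hd⟩ := μ
  obtain ⟨R, hR, hμR⟩ := exists_measure_compl_Icc_eq_zero hc
  have hle := map_inv_mul_le_volume hq (le_smul_volume_of_rnDeriv_le hac hd)
  obtain ⟨N, ν, hν, h⟩ := exists_compact_of_le_volume
    (μ.map (f := (q⁻¹ * ·)) (by fun_prop)) hle (map_mul_compl_Icc q⁻¹ hμR)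
  have hνq := map_mul_compl_Icc q hν
  refine ⟨⟨ν.map (f := (q * ·)) (by fun_prop), isCompact_support_of_compl_Icc hνq⟩, ?_⟩
  exact markovKreinRel_of_dilation (μ := (μ : Measure ℝ)) (ν := (ν.map (f := (q * ·)) (by fun_prop) :
    ProbabilityMeasure ℝ)) hR (by positivity) hμR hνq
    (mul_integral_cauchyKernel_eq hq _) (mul_integral_cauchyKernel_map q _) h

lemma CompactProb.exists_markovKreinRel {q : ℝ} (hq : q ≠ 0) (ν : CompactProb) :
    ∃ μ : BoundedDensityProb q, MarkovKreinRel q μ.toMeasure ν.toMeasure := by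
  obtain ⟨ν, hc⟩ := ν
  obtain ⟨R, hR, hνR⟩ := exists_measure_compl_Icc_eq_zero hc
  obtain ⟨μ, hle, hμ, h⟩ := exists_le_volume_of_compact
    (ν.map (f := (q⁻¹ * ·)) (by fun_prop)) (by positivity) (map_mul_compl_Icc q⁻¹ hνR)
  have hμq := map_mul_compl_Icc q hμ
  have hle' := map_mul_volume_le hq hle
  refine ⟨⟨μ.map (f := (q * ·)) (by fun_prop), isCompact_support_of_compl_Icc hμq,
    Measure.absolutelyContinuous_of_le_smul hle', rnDeriv_le_of_le_smul_volume hle'⟩, ?_⟩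
  exact markovKreinRel_of_dilation (μ := (μ.map (f := (q * ·)) (by fun_prop) :
    ProbabilityMeasure ℝ)) (ν := (ν : Measure ℝ)) (by positivity) hR hμq hνR
    (mul_integral_cauchyKernel_map q _) (mul_integral_cauchyKernel_eq hq _) h

lemma CompactProb.eq_of_markovKreinRel {q : ℝ} (hq : q ≠ 0) {μ : BoundedDensityProb q}
    {ν ν' : CompactProb} (h : MarkovKreinRel q μ.toMeasure ν.toMeasure)
    (h' : MarkovKreinRel q μ.toMeasure ν'.toMeasure) : ν = ν' := by
  obtain ⟨R, hR, hμ⟩ := exists_measure_compl_Icc_eq_zero (ρ := μ.toMeasure) μ.2.1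
  obtain ⟨S, hS, hν⟩ := exists_measure_compl_Icc_eq_zero (ρ := ν.toMeasure) ν.2
  obtain ⟨S', hS', hν'⟩ := exists_measure_compl_Icc_eq_zero (ρ := ν'.toMeasure) ν'.2
  have heq := h.right_unique hq hR hS hS' hμ hν hν' h'
  exact Subtype.ext (Subtype.ext heq)

lemma BoundedDensityProb.eq_of_markovKreinRel {q : ℝ} (hq : q ≠ 0) {μ μ' : BoundedDensityProb q}
    {ν : CompactProb} (h : MarkovKreinRel q μ.toMeasure ν.toMeasure)
    (h' : MarkovKreinRel q μ'.toMeasure ν.toMeasure) : μ = μ' := by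
  obtain ⟨R, hR, hμ⟩ := exists_measure_compl_Icc_eq_zero (ρ := μ.toMeasure) μ.2.1
  obtain ⟨R', hR', hμ'⟩ := exists_measure_compl_Icc_eq_zero (ρ := μ'.toMeasure) μ'.2.1
  obtain ⟨S, hS, hν⟩ := exists_measure_compl_Icc_eq_zero (ρ := ν.toMeasure) ν.2
  have heq := h.left_unique hq hR hR' hS hμ hμ' hν h'
  exact Subtype.ext (Subtype.ext heq)

theorem mainTheorem10 (q : ℝ) (hq : q ≠ 0) :
    (∀ μ : BoundedDensityProb q, ∃! ν : CompactProb, MarkovKreinRel q μ.toMeasure ν.toMeasure) ∧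
    ∃ MK : BoundedDensityProb q → CompactProb,
      (∀ (μ : BoundedDensityProb q) (ν : CompactProb),
        MK μ = ν ↔ MarkovKreinRel q μ.toMeasure ν.toMeasure) ∧
      Function.Bijective MK := by
  choose MK hMK using BoundedDensityProb.exists_markovKreinRel hq
  have hiff : ∀ (μ : BoundedDensityProb q) (ν : CompactProb),
      MK μ = ν ↔ MarkovKreinRel q μ.toMeasure ν.toMeasure := fun μ ν =>
    ⟨fun h => h ▸ hMK μ, fun h => CompactProb.eq_of_markovKreinRel hq (hMK μ) h⟩
  refine ⟨fun μ => ⟨MK μ, hMK μ, fun ν h => ((hiff μ ν).2 h).symm⟩, MK, hiff, ?_, ?_⟩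
  · intro μ μ' h
    exact BoundedDensityProb.eq_of_markovKreinRel hq (hMK μ) (h ▸ hMK μ')
  · intro ν
    obtain ⟨μ, hμ⟩ := CompactProb.exists_markovKreinRel hq ν
    exact ⟨μ, (hiff μ ν).2 hμ⟩
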